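/- For $m\ge 1$ a subgroup $G$ of $GL(m,\mathbb C)$ is called algebraic if it is the set of common zeros in $GL(m,\mathbb C)$ of a set of polynomials in the matrix entries. Its Lie algebra is the set of all $X\in gl(m,\mathbb C)$ with $dP_{1}(X)=0$ for every polynomial $P$ in the matrix entries that vanishes on $G$, where $dP_1$ is the differential of $P$ at the identity. A Lie subalgebra of $gl(m,\mathbb C)$ is called algebraic if it is the Lie algebra of some algebraic subgroup of $GL(m,\mathbb C)$. For $n\ge 3$ let $L_n$ be the model filiform Lie algebra, with basis $e_1,\dots,e_n$ and brackets $[e_1,e_i]=e_{i+1}$ for $2\le i\le n-1$, $[e_1,e_n]=0$, and $[e_i,e_j]=0$ for $i,j\ge 2$. **Corollary.** For every $n\ge 3$ there are an $m$ and an $n$-dimensional nilpotent Lie subalgebra of $gl(m,\mathbb C)$ that is not algebraic. Explicitly: (1) ($n=3$) Let $\alpha,\beta\in\mathbb C$ with $\alpha+\beta\ne 0$. The set $\mathfrak h$ of all matrices $$\begin{pmatrix} x_1+x_2 & x_1+x_2 & 0 & x_1\\ x_1+x_2 & x_1+x_2 & 0 & x_2\\ \alpha x_1+(\beta-1)x_2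 & \beta x_1+(\alpha+1)x_2 & 0 & x_3\\ 0&0&0&0\end{pmatrix},\qquad x_1,x_2,x_3\in\mathbb C,$$ is a $3$-dimensional nilpotent Lie subalgebra of $gl(4,\mathbb C)$, and it is not algebraic. (2) ($n\ge 4$) Let $a,\alpha,\beta\in\mathbb C$ with $a\neq 0$. Write $E_{i,j}$ for the matrix units of size $n+1$ and $A=a(E_{1,1}+E_{1,2}+E_{2,1}+E_{2,2})$, and put $$X_1=A+E_{1,n+1}+\alpha E_{n,1}+\beta E_{n,2}+\sum_{k=4}^{n}\tfrac{k-3}{k-2}E_{k,k-1},$$ $$X_2=A+E_{2,n+1}-E_{3,1}+E_{3,2}+\beta E_{n,1}+\alpha E_{n,2}+\sum_{k=4}^{n}\tfrac{1}{k-2}E_{k,k-1},$$ and $X_i=[X_1,X_{i-1}]$ for $3\le i\le n$. Let $\mathfrak h_n$ be the Lie subalgebra of $gl(n+1,\mathbb C)$ generated by $X_1,\dots,X_n$. Then $\mathfrak h_n$ is nilpotent of dimension $n$, there is an isomorphism of Lie algebras $L_n\to\mathfrak h_n$ with $e_i\mapsto X_i$ for all $i$, and $\mathfrak h_n$ is not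 algebraic. The semisimple part $X_{1,s}$ of $X_1$ in its Chevalley–Jordan decomposition is not in $\mathfrak h_n$; it is $X_{1,s}=X_1^{n-1}/(2a)^{n-2}$, and if $n\ge 5$ or $\alpha=\beta$, then also $X_{1,s}=X_1^{n-2}/(2a)^{n-3}$. -/

import Mathlib

attribute [local instance 100] LieRing.ofAssociativeRing

namespace NonAlgebraicNilpotent

noncomputable section

/-- The point of affine `m²`-space given by the entries of a matrix. -/
def entries {m : ℕ} (A : Matrix (Fin m) (Fin m) ℂ) : Fin m × Fin m → ℂ :=
  fun p => A p.1 p.2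

/-- A subgroup `G` of `GL(m,ℂ)` is an algebraic group if it is the set of all automorphisms
annihilated by some set `S` of polynomial functions of the matrix entries. -/
def IsAlgebraicGroup {m : ℕ} (G : Subgroup (GL (Fin m) ℂ)) : Prop :=
  ∃ S : Set (MvPolynomial (Fin m × Fin m) ℂ),
    ∀ g : GL (Fin m) ℂ, g ∈ G ↔
      ∀ P ∈ S, MvPolynomial.eval (entries (g : Matrix (Fin m) (Fin m) ℂ)) P = 0

/-- The ideal `I(G)` of all polynomials in the matrix entries that vanish on `G`. -/
def groupIdeal {m : ℕ} (G : Subgroup (GL (Fin m) ℂ)) :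
    Ideal (MvPolynomial (Fin m × Fin m) ℂ) :=
  MvPolynomial.vanishingIdeal ℂ
    {x | ∃ g ∈ G, x = entries (g : Matrix (Fin m) (Fin m) ℂ)}

/-- The differential of the polynomial function `P` at the identity matrix, applied to `X`. -/
def diffAtOne {m : ℕ} (P : MvPolynomial (Fin m × Fin m) ℂ) (X : Matrix (Fin m) (Fin m) ℂ) : ℂ :=
  ∑ p : Fin m × Fin m,
    MvPolynomial.eval (entries (1 : Matrix (Fin m) (Fin m) ℂ)) (MvPolynomial.pderiv p P) *
      X p.1 p.2

/-- A Lie subalgebra of `gl(m,ℂ)` is algebraic if it is the Lie algebra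
`{X | dP(X) = 0 for all P ∈ I(G)}` of an algebraic group `G` of automorphisms of `ℂ^m`. -/
def IsAlgebraic {m : ℕ} (L : LieSubalgebra ℂ (Matrix (Fin m) (Fin m) ℂ)) : Prop :=
  ∃ G : Subgroup (GL (Fin m) ℂ), IsAlgebraicGroup G ∧
    ∀ X : Matrix (Fin m) (Fin m) ℂ, X ∈ L ↔ ∀ P ∈ groupIdeal G, diffAtOne P X = 0

/-- `S` is the semisimple part of `X` in the Chevalley-Jordan decomposition
`X = S + (X - S)`: `S` is semisimple, `X - S` is nilpotent and they commute. -/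
def IsSemisimplePart {m : ℕ} (X S : Matrix (Fin m) (Fin m) ℂ) : Prop :=
  Module.End.IsSemisimple (Matrix.toLin' S) ∧ IsNilpotent (X - S) ∧ Commute S (X - S)

/-- The general element of the three-dimensional algebra `h` in `gl(4,ℂ)`. -/
def hMatrix (α β x₁ x₂ x₃ : ℂ) : Matrix (Fin 4) (Fin 4) ℂ :=
  !![x₁ + x₂, x₁ + x₂, 0, x₁;
     x₁ + x₂, x₁ + x₂, 0, x₂;
     α * x₁ + (β - 1) * x₂, β * x₁ + (α + 1) * x₂, 0, x₃;
     0, 0, 0, 0]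

/-- The matrix `X₁` in `gl(n+1,ℂ)`; rows and columns are numbered from `0`. -/
def matX₁ (n : ℕ) (a α β : ℂ) : Matrix (Fin (n + 1)) (Fin (n + 1)) ℂ :=
  Matrix.of fun i j =>
    if (i : ℕ) < 2 ∧ (j : ℕ) < 2 then a
    else if (i : ℕ) = 0 ∧ (j : ℕ) = n then 1
    else if (i : ℕ) + 1 = n ∧ (j : ℕ) = 0 then α
    else if (i : ℕ) + 1 = n ∧ (j : ℕ) = 1 then β
    else if 2 ≤ (j : ℕ) ∧ (i : ℕ) = (j : ℕ) + 1 ∧ (i : ℕ) < n then ((j : ℂ) - 1) / (j : ℂ)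
    else 0

/-- The matrix `X₂` in `gl(n+1,ℂ)`; rows and columns are numbered from `0`. -/
def matX₂ (n : ℕ) (a α β : ℂ) : Matrix (Fin (n + 1)) (Fin (n + 1)) ℂ :=
  Matrix.of fun i j =>
    if (i : ℕ) < 2 ∧ (j : ℕ) < 2 then a
    else if (i : ℕ) = 1 ∧ (j : ℕ) = n then 1
    else if (i : ℕ) = 2 ∧ (j : ℕ) = 0 then -1
    else if (i : ℕ) = 2 ∧ (j : ℕ) = 1 then 1
    else if (i : ℕ) + 1 = n ∧ (j : ℕ) = 0 then β
    else if (i : ℕ) + 1 = n ∧ (j : ℕ) = 1 then α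
    else if 2 ≤ (j : ℕ) ∧ (i : ℕ) = (j : ℕ) + 1 ∧ (i : ℕ) < n then 1 / (j : ℂ)
    else 0

/-- The sequence `X₁, X₂, X₃ = [X₁, X₂], X₄ = [X₁, X₃], …`; `genX n a α β k` is `X_{k+1}`. -/
def genX (n : ℕ) (a α β : ℂ) : ℕ → Matrix (Fin (n + 1)) (Fin (n + 1)) ℂ
  | 0 => matX₁ n a α β
  | 1 => matX₂ n a α β
  | k + 2 => ⁅matX₁ n a α β, genX n a α β (k + 1)⁆

/-- The Lie subalgebra `h_n` of `gl(n+1,ℂ)` generated by `X₁, …, X_n`. -/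
def hAlg (n : ℕ) (a α β : ℂ) : LieSubalgebra ℂ (Matrix (Fin (n + 1)) (Fin (n + 1)) ℂ) :=
  LieSubalgebra.lieSpan ℂ _ (Set.range fun k : Fin n => genX n a α β k)

/-- The underlying space of the model filiform Lie algebra `L_n`. -/
def ModelFiliform (n : ℕ) : Type := Fin n → ℂ

namespace ModelFiliform

instance (n : ℕ) : AddCommGroup (ModelFiliform n) := inferInstanceAs (AddCommGroup (Fin n → ℂ))

instance (n : ℕ) : Module ℂ (ModelFiliform n) := inferInstanceAs (Module ℂ (Fin n → ℂ))

/-- The standard basis vector; `e n k` is the basis element with number `k + 1`. -/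
def e (n : ℕ) (k : Fin n) : ModelFiliform n := (Pi.single k 1 : Fin n → ℂ)

/-- The bracket of `L_n`, in coordinates; see `bracket_e_first` and `bracket_e_e`. -/
instance (n : ℕ) : Bracket (ModelFiliform n) (ModelFiliform n) where
  bracket x y := fun k =>
    if 2 ≤ (k : ℕ) then
      x ⟨0, k.pos⟩ * y ⟨k - 1, by omega⟩ - x ⟨k - 1, by omega⟩ * y ⟨0, k.pos⟩
    else 0

theorem bracket_apply {n : ℕ} (x y : ModelFiliform n) (k : Fin n) :
    ⁅x, y⁆ k = if 2 ≤ (k : ℕ) then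
      x ⟨0, k.pos⟩ * y ⟨k - 1, by omega⟩ - x ⟨k - 1, by omega⟩ * y ⟨0, k.pos⟩ else 0 := rfl

theorem add_apply {n : ℕ} (x y : ModelFiliform n) (k : Fin n) : (x + y) k = x k + y k := rfl

theorem smul_apply {n : ℕ} (c : ℂ) (x : ModelFiliform n) (k : Fin n) : (c • x) k = c * x k := rfl

theorem zero_apply {n : ℕ} (k : Fin n) : (0 : ModelFiliform n) k = 0 := rfl

instance (n : ℕ) : LieRing (ModelFiliform n) where
  add_lie x y z := by
    funext k
    simp only [bracket_apply, add_apply]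
    split_ifs <;> ring
  lie_add x y z := by
    funext k
    simp only [bracket_apply, add_apply]
    split_ifs <;> ring
  lie_self x := by
    funext k
    simp only [bracket_apply, zero_apply]
    split_ifs <;> ring
  leibniz_lie x y z := by
    funext k
    simp only [bracket_apply, add_apply]
    split_ifs <;> first | omega | ring

instance (n : ℕ) : LieAlgebra ℂ (ModelFiliform n) where
  lie_smul c x y := by
    funext k
    simp only [bracket_apply, smul_apply]
    split_ifs <;> ring

theorem e_apply {n : ℕ} (i k : Fin n) : e n i k = if (k : ℕ) = (i : ℕ) then 1 else 0 := by
  exact (Pi.single_apply i (1 : ℂ) k).trans (by simp only [Fin.ext_iff])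

theorem bracket_e_first {n : ℕ} (i : ℕ) (hi : 1 ≤ i) (hn : i + 1 < n) :
    ⁅e n ⟨0, by omega⟩, e n ⟨i, by omega⟩⁆ = e n ⟨i + 1, hn⟩ := by
  funext k
  simp only [bracket_apply, e_apply]
  split_ifs <;> first | omega | simp

theorem bracket_e_last {n : ℕ} (hn : 2 ≤ n) :
    ⁅e n ⟨0, by omega⟩, e n ⟨n - 1, by omega⟩⁆ = 0 := by
  funext k
  simp only [bracket_apply, e_apply, zero_apply]
  split_ifs <;> first | omega | simp

theorem bracket_e_e {n : ℕ} (i j : Fin n) (hi : 1 ≤ (i : ℕ)) (hj : 1 ≤ (j : ℕ)) :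
    ⁅e n i, e n j⁆ = 0 := by
  funext k
  simp only [bracket_apply, e_apply, zero_apply]
  split_ifs <;> first | omega | simp

end ModelFiliform

end

end NonAlgebraicNilpotent

/-!
The ideal `I(G)` of an algebraic group is stable under left translations, hence under the
derivations `D_Y` that extend `Y ∈ 𝔤` to left-invariant vector fields. If `S` is the semisimple
part of `Y`, then `D_S` acts on the generalized `μ`-eigenspace of `D_Y` as multiplication by `μ`
(this holds for linear forms, and both sides are multiplicative), so it preserves every
`D_Y`-stable subspace, in particular `I(G)`; hence `S ∈ 𝔤`. It therefore suffices to exhibit an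
element whose semisimple part, here a multiple of a power of it, leaves the Lie algebra.

For `n ≥ 4`, the relations `[X₂, X₃] = 0`, `[X₁, X₃] = 2 X₂ X₃` and `X₃² = X₂² X₃` give
`X_{k+3} = (k+1)! X₂^k X₃`, and so the relations of `L_n`. Every element of `𝔥_n` has opposite
entries in the positions `(3, 1)` and `(2, n + 1)`, and the semisimple part of `X₁` has not.
-/

namespace NonAlgebraicNilpotent

open Module MvPolynomial Matrix

section Derivations

variable {R A : Type*} [CommRing R] [CommRing A] [Algebra R A]

theorem mul_mem_maxGenEigenspace (D : Derivation R A A) {μ ν : R} {p q : A}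
    (hp : p ∈ End.maxGenEigenspace D.toLinearMap μ)
    (hq : q ∈ End.maxGenEigenspace D.toLinearMap ν) :
    p * q ∈ End.maxGenEigenspace D.toLinearMap (μ + ν) := by
  simp only [End.mem_maxGenEigenspace] at hp hq ⊢
  obtain ⟨i, hi⟩ := hp
  obtain ⟨j, hj⟩ := hq
  induction h : i + j generalizing i j p q with
  | zero =>
    obtain ⟨rfl, rfl⟩ : i = 0 ∧ j = 0 := by omega
    exact ⟨0, by simp_all⟩
  | succ s ih =>
    rcases i with _ | i
    · exact ⟨0, by simp_all⟩
    rcases j with _ | j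
    · exact ⟨0, by simp_all⟩
    have leibniz : (D.toLinearMap - (μ + ν) • (1 : End R A)) (p * q) =
        p * (D.toLinearMap - ν • (1 : End R A)) q +
          (D.toLinearMap - μ • (1 : End R A)) p * q := by
      simp only [LinearMap.sub_apply, LinearMap.smul_apply, End.one_apply, Derivation.coeFn_coe,
        Derivation.leibniz, smul_eq_mul, Algebra.smul_def (A := A), map_add]
      ring
    rw [pow_succ] at hi hj
    obtain ⟨k, hk⟩ := ih (i + 1) (by rwa [pow_succ]) j hj (by omega)
    obtain ⟨l, hl⟩ := ih i hi (j + 1) (by rwa [pow_succ]) (by omega)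
    refine ⟨max k l + 1, ?_⟩
    rw [pow_succ, End.mul_apply, leibniz, map_add,
      End.pow_map_zero_of_le (le_max_left k l) hk,
      End.pow_map_zero_of_le (le_max_right k l) hl, add_zero]

instance gradedMonoid_eigenspace_inf_maxGenEigenspace (D E : Derivation R A A) :
    SetLike.GradedMonoid fun μ =>
      End.eigenspace D.toLinearMap μ ⊓ End.maxGenEigenspace E.toLinearMap μ where
  one_mem := by
    refine ⟨End.mem_eigenspace_iff.2 (by simp), (End.mem_maxGenEigenspace _ _ _).2 ⟨1, ?_⟩⟩
    simp
  mul_mem μ ν p q hp hq := by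
    refine ⟨End.mem_eigenspace_iff.2 ?_, mul_mem_maxGenEigenspace E hp.2 hq.2⟩
    have hDp : D p = μ • p := End.mem_eigenspace_iff.1 hp.1
    have hDq : D q = ν • q := End.mem_eigenspace_iff.1 hq.1
    simp only [Derivation.coeFn_coe, Derivation.leibniz, hDp, hDq, smul_eq_mul, Algebra.smul_def,
      map_add]
    ring

theorem iSup_eq_top_of_adjoin_eq_top {ι : Type*} [AddMonoid ι] (W : ι → Submodule R A)
    [SetLike.GradedMonoid W] {s : Set A} (hs : Algebra.adjoin R s = ⊤)
    (hsW : s ⊆ (⨆ i, W i : Submodule R A)) : ⨆ i, W i = ⊤ := by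
  have hmul : (⨆ i, W i) * ⨆ i, W i ≤ ⨆ i, W i := by
    simp only [Submodule.iSup_mul, Submodule.mul_iSup, iSup_le_iff, Submodule.mul_le]
    exact fun j i p hp q hq =>
      Submodule.mem_iSup_of_mem (i + j) (SetLike.GradedMul.mul_mem hp hq)
  let B : Subalgebra R A := (⨆ i, W i).toSubalgebra
    (Submodule.mem_iSup_of_mem 0 SetLike.GradedOne.one_mem)
    fun p q hp hq => hmul (Submodule.mul_mem_mul hp hq)
  have hB : ⊤ ≤ B := hs ▸ Algebra.adjoin_le hsW
  exact eq_top_iff.2 fun p _ => hB Algebra.mem_top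

end Derivations

section DiagonalizablePart

theorem map_mem_maxGenEigenspace {R V V' : Type*} [CommRing R] [AddCommGroup V] [Module R V]
    [AddCommGroup V'] [Module R V'] {f : End R V} {g : End R V'} {T : V →ₗ[R] V'}
    (h : g ∘ₗ T = T ∘ₗ f) {μ : R} {x : V} (hx : x ∈ f.maxGenEigenspace μ) :
    T x ∈ g.maxGenEigenspace μ := by
  obtain ⟨k, hk⟩ := (End.mem_maxGenEigenspace _ _ _).1 hx
  have hμ : (g - μ • (1 : End R V')) ∘ₗ T = T ∘ₗ (f - μ • (1 : End R V)) := by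
    ext v
    simpa using LinearMap.congr_fun h v
  refine (End.mem_maxGenEigenspace _ _ _).2 ⟨k, ?_⟩
  rw [← LinearMap.comp_apply, End.commute_pow_left_of_commute hμ, LinearMap.comp_apply, hk,
    map_zero]

variable {K V : Type*} [Field K] [AddCommGroup V] [Module K V]

theorem mem_of_sum_mem_of_mem_maxGenEigenspace {f : End K V} {p : Submodule K V}
    (hp : p ∈ f.invtSubmodule) {t : Finset K} {v : K → V}
    (hv : ∀ μ ∈ t, v μ ∈ f.maxGenEigenspace μ) (hsum : ∑ μ ∈ t, v μ ∈ p) :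
    ∀ μ ∈ t, v μ ∈ p := by
  classical
  have hquot : ∀ μ ∈ t, p.mkQ (v μ) ∈ End.maxGenEigenspace (p.mapQ p f hp) μ :=
    fun μ hμ => map_mem_maxGenEigenspace (p.mapQ_mkQ p f (h := hp)) (hv μ hμ)
  have hzero : ∑ μ ∈ t, p.mkQ (v μ) = 0 := by
    rwa [← map_sum, Submodule.mkQ_apply, Submodule.Quotient.mk_eq_zero]
  intro μ hμ
  rw [← Submodule.Quotient.mk_eq_zero]
  exact (iSupIndep_iff_finsetSum_eq_zero_imp_eq_zero _).1 (End.independent_maxGenEigenspace _)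
    t _ hquot hzero μ hμ

/-- `s` is the diagonalizable part of `f`: the space is spanned by eigenvectors of `s` that are
generalized eigenvectors of `f` for the same eigenvalue. This extends the semisimple part of the
Chevalley–Jordan decomposition to spaces of infinite dimension. -/
def IsDiagonalizablePart (f s : End K V) : Prop :=
  ⨆ μ, s.eigenspace μ ⊓ f.maxGenEigenspace μ = ⊤

theorem IsDiagonalizablePart.invtSubmodule_le {f s : End K V} (h : IsDiagonalizablePart f s) :
    f.invtSubmodule ≤ s.invtSubmodule := by
  refine fun p hp => (End.mem_invtSubmodule_iff_forall_mem_of_mem s).2 fun x hx => ?_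
  obtain ⟨v, hv, rfl⟩ := (Submodule.mem_iSup_iff_exists_finsupp _ _).1
    (h ▸ Submodule.mem_top : x ∈ ⨆ μ, s.eigenspace μ ⊓ f.maxGenEigenspace μ)
  rw [Finsupp.sum, map_sum]
  refine sum_mem fun μ hμ => ?_
  rw [End.mem_eigenspace_iff.1 (hv μ).1]
  exact p.smul_mem μ (mem_of_sum_mem_of_mem_maxGenEigenspace hp (fun ν _ => (hv ν).2) hx μ hμ)

theorem isDiagonalizablePart_of_isSemisimple [IsAlgClosed K] [FiniteDimensional K V]
    {f s : End K V} (hs : s.IsSemisimple) (hcomm : Commute f s) (hnil : IsNilpotent (f - s)) :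
    IsDiagonalizablePart f s := by
  have hle (μ : K) : f.maxGenEigenspace μ ≤ s.eigenspace μ := fun v hv =>
    End.mem_eigenspace_iff.2 <| End.apply_eq_of_mem_of_comm_of_isFinitelySemisimple_of_isNil hv
      hcomm hs.isFinitelySemisimple hnil
  simp only [IsDiagonalizablePart, inf_eq_right.2 (hle _), End.iSup_maxGenEigenspace_eq_top]

theorem IsSemisimplePart.isDiagonalizablePart {m : ℕ} {Y S : Matrix (Fin m) (Fin m) ℂ}
    (h : IsSemisimplePart Y S) : IsDiagonalizablePart (toLin' Y) (toLin' S) := by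
  obtain ⟨hss, hnil, hcomm⟩ := h
  refine isDiagonalizablePart_of_isSemisimple hss ?_ ?_
  · have hYS : Commute Y S := by simpa using ((Commute.refl S).add_right hcomm).symm
    exact hYS.map toLinAlgEquiv'
  · rw [← map_sub]
    exact hnil.map toLinAlgEquiv'

end DiagonalizablePart

section LeftInvariant

variable {ι R : Type*} [Fintype ι] [CommRing R]

/-- The linear form `x ↦ (x v)_i` on matrix space, as a function of the vector `v`. -/
noncomputable def rowForm (i : ι) : (ι → R) →ₗ[R] MvPolynomial (ι × ι) R :=
  Fintype.linearCombination R fun j => X (i, j)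

/-- The left-invariant vector field on matrix space with value `M` at the identity, acting on
polynomials in the matrix entries: its value at the matrix `x` is `x * M`. -/
noncomputable def leftInvariant (M : Matrix ι ι R) :
    Derivation R (MvPolynomial (ι × ι) R) (MvPolynomial (ι × ι) R) :=
  mkDerivation R fun p => rowForm p.1 (M.col p.2)

/-- The pullback of polynomials in the matrix entries along left multiplication by `g`. -/
noncomputable def leftTranslation (g : Matrix ι ι R) :
    MvPolynomial (ι × ι) R →ₐ[R] MvPolynomial (ι × ι) R :=
  aeval fun p => ∑ k, g p.1 k • X (k, p.2)

theorem rowForm_single_one [DecidableEq ι] (i j : ι) :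
    rowForm i (Pi.single j 1) = (X (i, j) : MvPolynomial (ι × ι) R) := by
  simp [rowForm]

theorem leftInvariant_comp_rowForm [DecidableEq ι] (M : Matrix ι ι R) (i : ι) :
    (leftInvariant M).toLinearMap ∘ₗ rowForm i = rowForm i ∘ₗ toLin' M := by
  refine LinearMap.pi_ext' fun j => LinearMap.ext_ring ?_
  simp [rowForm_single_one, leftInvariant, mkDerivation_X]

theorem mkDerivation_apply_eq_sum {σ : Type*} [Fintype σ] (f : σ → MvPolynomial σ R)
    (P : MvPolynomial σ R) : mkDerivation R f P = ∑ i, f i * pderiv i P := by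
  classical
  have hsum (Q : MvPolynomial σ R) : (∑ i, f i • pderiv i) Q = ∑ i, f i * pderiv i Q := by
    rw [← Derivation.coeFnAddMonoidHom_apply, map_sum, Finset.sum_apply]
    rfl
  have h : mkDerivation R f = ∑ i, f i • pderiv i := derivation_ext fun j => by
    simp [hsum, mkDerivation_X, pderiv_X, Pi.single_apply]
  rw [h, hsum]

theorem leftInvariant_leftTranslation (g M : Matrix ι ι R) (P : MvPolynomial (ι × ι) R) :
    leftInvariant M (leftTranslation g P) = leftTranslation g (leftInvariant M P) := by
  induction P using MvPolynomial.induction_on with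
  | C a => simp [leftTranslation]
  | add P Q hP hQ => simp only [map_add, hP, hQ]
  | mul_X P p hP =>
    have hX : leftInvariant M (leftTranslation g (X p)) =
        leftTranslation g (leftInvariant M (X p)) := by
      simp only [leftTranslation, leftInvariant, rowForm, Fintype.linearCombination_apply, aeval_X,
        mkDerivation_X, map_sum, map_smul, Derivation.map_smul, Finset.smul_sum]
      rw [Finset.sum_comm]
      exact Finset.sum_congr rfl fun _ _ => Finset.sum_congr rfl fun _ _ => smul_comm _ _ _
    simp only [map_mul, map_add, Derivation.leibniz, smul_eq_mul, hP, hX]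

theorem eval_leftTranslation (g h : Matrix ι ι R) (P : MvPolynomial (ι × ι) R) :
    eval (fun p => h p.1 p.2) (leftTranslation g P) = eval (fun p => (g * h) p.1 p.2) P := by
  suffices (aeval fun p : ι × ι => h p.1 p.2).comp (leftTranslation g) =
      aeval fun p => (g * h) p.1 p.2 from DFunLike.congr_fun this P
  ext p
  simp [leftTranslation, Matrix.mul_apply]

end LeftInvariant

theorem isDiagonalizablePart_leftInvariant {ι K : Type*} [Fintype ι] [DecidableEq ι] [Field K]
    {Y S : Matrix ι ι K} (h : IsDiagonalizablePart (toLin' Y) (toLin' S)) :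
    IsDiagonalizablePart (leftInvariant Y).toLinearMap (leftInvariant S).toLinearMap := by
  refine iSup_eq_top_of_adjoin_eq_top _ adjoin_range_X ?_
  rintro _ ⟨⟨i, j⟩, rfl⟩
  rw [SetLike.mem_coe, ← rowForm_single_one]
  suffices ⊤ ≤ (⨆ μ, End.eigenspace (leftInvariant S).toLinearMap μ ⊓
      End.maxGenEigenspace (leftInvariant Y).toLinearMap μ).comap (rowForm i) from
    this Submodule.mem_top
  rw [← h, iSup_le_iff]
  refine fun μ v hv => Submodule.mem_iSup_of_mem μ ⟨End.mem_eigenspace_iff.2 ?_, ?_⟩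
  · rw [← LinearMap.comp_apply, leftInvariant_comp_rowForm, LinearMap.comp_apply,
      End.mem_eigenspace_iff.1 hv.1, map_smul]
  · exact map_mem_maxGenEigenspace (leftInvariant_comp_rowForm Y i) hv.2

section Chevalley

variable {m : ℕ} {G : Subgroup (GL (Fin m) ℂ)}

theorem diffAtOne_eq_eval_leftInvariant (P : MvPolynomial (Fin m × Fin m) ℂ)
    (M : Matrix (Fin m) (Fin m) ℂ) : diffAtOne P M = eval (entries 1) (leftInvariant M P) := by
  rw [leftInvariant, mkDerivation_apply_eq_sum, map_sum, diffAtOne]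
  refine Finset.sum_congr rfl fun p _ => ?_
  simp [rowForm, Fintype.linearCombination_apply, entries, one_apply, mul_comm]

theorem mem_groupIdeal {P : MvPolynomial (Fin m × Fin m) ℂ} :
    P ∈ groupIdeal G ↔ ∀ g ∈ G, eval (entries (g : Matrix (Fin m) (Fin m) ℂ)) P = 0 := by
  simp only [groupIdeal, mem_vanishingIdeal_iff, Set.mem_ofPred_eq, forall_exists_index, and_imp,
    aeval_eq_eval]
  exact ⟨fun h g hg => h _ g hg rfl, fun h x g hg hx => hx ▸ h g hg⟩

theorem leftTranslation_mem_groupIdeal {g : GL (Fin m) ℂ} (hg : g ∈ G)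
    {P : MvPolynomial (Fin m × Fin m) ℂ} (hP : P ∈ groupIdeal G) :
    leftTranslation (g : Matrix (Fin m) (Fin m) ℂ) P ∈ groupIdeal G :=
  mem_groupIdeal.2 fun h hh =>
    (eval_leftTranslation _ _ _).trans (mem_groupIdeal.1 hP (g * h) (mul_mem hg hh))

theorem groupIdeal_mem_invtSubmodule {M : Matrix (Fin m) (Fin m) ℂ}
    (hM : ∀ P ∈ groupIdeal G, diffAtOne P M = 0) :
    (groupIdeal G).restrictScalars ℂ ∈ End.invtSubmodule (leftInvariant M).toLinearMap := by
  refine fun P hP => mem_groupIdeal.2 fun g hg => ?_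
  have h := hM _ (leftTranslation_mem_groupIdeal hg hP)
  rw [diffAtOne_eq_eval_leftInvariant, leftInvariant_leftTranslation] at h
  have heval := eval_leftTranslation (g : Matrix (Fin m) (Fin m) ℂ) 1 (leftInvariant M P)
  rw [mul_one] at heval
  exact heval.symm.trans h

theorem IsAlgebraic.semisimplePart_mem {L : LieSubalgebra ℂ (Matrix (Fin m) (Fin m) ℂ)}
    (hL : IsAlgebraic L) {Y S : Matrix (Fin m) (Fin m) ℂ} (hY : Y ∈ L)
    (hS : IsSemisimplePart Y S) : S ∈ L := by
  obtain ⟨G, -, hG⟩ := hL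
  rw [hG] at hY ⊢
  intro P hP
  have hSP : leftInvariant S P ∈ groupIdeal G :=
    (isDiagonalizablePart_leftInvariant hS.isDiagonalizablePart).invtSubmodule_le
      (groupIdeal_mem_invtSubmodule hY) hP
  rw [diffAtOne_eq_eval_leftInvariant]
  exact mem_groupIdeal.1 hSP 1 (one_mem G)

end Chevalley

section SemisimplePart

theorem isSemisimple_of_mul_self_eq_smul {K V : Type*} [Field K] [AddCommGroup V] [Module K V]
    {s : End K V} {c : K} (hc : c ≠ 0) (hs : s * s = c • s) : s.IsSemisimple := by
  refine End.isSemisimple_of_squarefree_aeval_eq_zero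
    (p := Polynomial.X * (Polynomial.X - Polynomial.C c)) ?_ ?_
  · have hcoprime : IsCoprime (Polynomial.X : Polynomial K) (Polynomial.X - Polynomial.C c) := by
      simpa using Polynomial.isCoprime_X_sub_C_of_isUnit_sub (a := 0) (b := c) (by simpa using hc)
    exact (squarefree_mul_iff).2 ⟨hcoprime.isRelPrime, Polynomial.prime_X.squarefree,
      (Polynomial.prime_X_sub_C c).squarefree⟩
  · simp [mul_sub, hs, ← Algebra.smul_def]

section

variable {K A : Type*} [Field K] [Ring A] [Algebra K A] {y : A} {c : K} {k : ℕ}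

theorem mul_smul_pow_of_pow_eq_smul_pow (hy : y ^ (k + 2) = c • y ^ (k + 1)) (d : K) :
    y * d • y ^ (k + 1) = c • d • y ^ (k + 1) := by
  rw [mul_smul_comm, ← pow_succ', hy, smul_comm]

theorem pow_mul_pow_of_pow_eq_smul_pow (hy : y ^ (k + 2) = c • y ^ (k + 1)) (j : ℕ) :
    y ^ j * y ^ (k + 1) = c ^ j • y ^ (k + 1) := by
  induction j with
  | zero => simp
  | succ j ih => rw [pow_succ', mul_assoc, ih, mul_smul_pow_of_pow_eq_smul_pow hy, smul_smul,
      ← pow_succ']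

theorem inv_smul_pow_mul_self (hc : c ≠ 0) (hy : y ^ (k + 2) = c • y ^ (k + 1)) :
    (c ^ k)⁻¹ • y ^ (k + 1) * (c ^ k)⁻¹ • y ^ (k + 1) = c • (c ^ k)⁻¹ • y ^ (k + 1) := by
  rw [smul_mul_smul_comm, pow_mul_pow_of_pow_eq_smul_pow hy, smul_smul, smul_smul]
  congr 1
  field_simp
  ring

theorem isNilpotent_sub_of_pow_eq_smul {s : A} {d : K} (hcomm : Commute y s)
    (hs : y * s = s * s) (hpow : y ^ k = d • s) : IsNilpotent (y - s) := by
  have hzero : (y - s) * s = 0 := by rw [sub_mul, hs, sub_self]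
  have hstep (j : ℕ) : (y - s) ^ (j + 1) = (y - s) * y ^ j := by
    induction j with
    | zero => simp
    | succ j ih =>
      rw [pow_succ, ih, mul_sub, mul_assoc, ← pow_succ, mul_assoc, (hcomm.pow_left j).eq,
        ← mul_assoc, hzero, zero_mul, sub_zero]
  exact ⟨k + 1, by rw [hstep, hpow, mul_smul_comm, hzero, smul_zero]⟩

end

theorem isSemisimplePart_inv_smul_pow {m k : ℕ} {Y : Matrix (Fin m) (Fin m) ℂ} {c : ℂ}
    (hc : c ≠ 0) (hY : Y ^ (k + 2) = c • Y ^ (k + 1)) :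
    IsSemisimplePart Y ((c ^ k)⁻¹ • Y ^ (k + 1)) := by
  have hSS := inv_smul_pow_mul_self hc hY
  have hcomm : Commute Y ((c ^ k)⁻¹ • Y ^ (k + 1)) :=
    ((Commute.refl Y).pow_right (k + 1)).smul_right _
  refine ⟨isSemisimple_of_mul_self_eq_smul hc ?_, isNilpotent_sub_of_pow_eq_smul (d := c ^ k)
    (k := k + 1) hcomm ?_ ?_, hcomm.symm.sub_right (Commute.refl _)⟩
  · rw [End.mul_eq_comp, ← toLin'_mul, hSS, map_smul]
  · rw [mul_smul_pow_of_pow_eq_smul_pow hY, hSS]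
  · rw [smul_inv_smul₀ (pow_ne_zero k hc)]

end SemisimplePart

namespace ModelFiliform

variable {n : ℕ} {L : Type*} [LieRing L] [LieAlgebra ℂ L]

/-- The basis `e₁, …, e_n` of `L_n`. -/
noncomputable def basis (n : ℕ) : Basis (Fin n) ℂ (ModelFiliform n) :=
  Pi.basisFun ℂ (Fin n)

theorem basis_apply (k : Fin n) : basis n k = e n k :=
  Pi.basisFun_apply ℂ (Fin n) k

instance : FiniteDimensional ℂ (ModelFiliform n) := .of_basis (basis n)

theorem finrank_of_equiv (φ : ModelFiliform n ≃ₗ⁅ℂ⁆ L) : finrank ℂ L = n := by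
  rw [← φ.toLinearEquiv.finrank_eq, finrank_eq_card_basis (basis n), Fintype.card_fin]

theorem ad_pow_succ_apply_eq_zero (x y : ModelFiliform n) (s : ℕ) (k : Fin n)
    (hk : (k : ℕ) ≤ s + 1) : ((LieAlgebra.ad ℂ (ModelFiliform n) x ^ (s + 1)) y) k = 0 := by
  induction s generalizing k with
  | zero =>
    rw [zero_add, pow_one, LieAlgebra.ad_apply, bracket_apply, if_neg (by omega)]
  | succ s ih =>
    rw [pow_succ', End.mul_apply, LieAlgebra.ad_apply, bracket_apply]
    split_ifs
    · rw [ih ⟨k - 1, by omega⟩ (by simp only; omega), ih ⟨0, k.pos⟩ (by simp), mul_zero, mul_zero,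
        sub_zero]
    · rfl

theorem isNilpotent (n : ℕ) : LieRing.IsNilpotent (ModelFiliform n) := by
  rw [LieAlgebra.isNilpotent_iff_forall (R := ℂ)]
  refine fun x => ⟨n + 1, LinearMap.ext fun y => funext fun k => ?_⟩
  exact ad_pow_succ_apply_eq_zero x y n k (by omega)

theorem isNilpotent_of_equiv (φ : ModelFiliform n ≃ₗ⁅ℂ⁆ L) : LieRing.IsNilpotent L :=
  φ.nilpotent_iff_equiv_nilpotent.1 (isNilpotent n)

section Lift

/-- The linear map `L_n → L` with `e_i ↦ X_i`; `X k` stands for `X_{k+1}`. -/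
noncomputable def liftLinear (n : ℕ) (X : ℕ → L) : ModelFiliform n →ₗ[ℂ] L :=
  (basis n).constr ℂ fun k => X k

theorem liftLinear_e (X : ℕ → L) (k : Fin n) : liftLinear n X (e n k) = X k := by
  rw [← basis_apply]
  exact (basis n).constr_basis ℂ _ k

theorem liftLinear_bracket_e {X : ℕ → L} (h_succ : ∀ k, ⁅X 0, X (k + 1)⁆ = X (k + 2))
    (h_comm : ∀ i j, ⁅X (i + 1), X (j + 1)⁆ = 0) (h_zero : X n = 0) (i j : Fin n) :
    liftLinear n X ⁅e n i, e n j⁆ = ⁅X i, X j⁆ := by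
  have h_first {k : ℕ} (h0 : 0 < n) (hk : k + 1 < n) :
      liftLinear n X ⁅e n ⟨0, h0⟩, e n ⟨k + 1, hk⟩⁆ = X (k + 2) := by
    rcases Nat.lt_or_eq_of_le hk with hlt | rfl
    · rw [bracket_e_first (k + 1) (by omega) hlt, liftLinear_e]
    · have h_last : ⁅e (k + 2) ⟨0, h0⟩, e (k + 2) ⟨k + 1, hk⟩⁆ = 0 := bracket_e_last (by omega)
      rw [h_last, map_zero, h_zero]
  obtain ⟨_ | i, hi⟩ := i <;> obtain ⟨_ | j, hj⟩ := j
  · rw [lie_self, lie_self, map_zero]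
  · rw [h_first, h_succ]
  · rw [← lie_skew, map_neg, h_first, ← lie_skew, h_succ]
  · rw [bracket_e_e _ _ (by simp) (by simp), map_zero, h_comm]

/-- The homomorphism `L_n → L`, `e_i ↦ X_i`, given by a sequence that satisfies the relations of
`L_n`; `X k` stands for `X_{k+1}`. -/
noncomputable def lift {X : ℕ → L} (h_succ : ∀ k, ⁅X 0, X (k + 1)⁆ = X (k + 2))
    (h_comm : ∀ i j, ⁅X (i + 1), X (j + 1)⁆ = 0) (h_zero : X n = 0) : ModelFiliform n →ₗ⁅ℂ⁆ L where
  __ := liftLinear n X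
  map_lie' {x y} := by
    have h : (LieModule.toEnd ℂ (ModelFiliform n) (ModelFiliform n)).toLinearMap.compr₂
        (liftLinear n X) =
        (LieModule.toEnd ℂ L L).toLinearMap.compl₁₂ (liftLinear n X) (liftLinear n X) := by
      refine (basis n).ext fun i => (basis n).ext fun j => ?_
      rw [basis_apply, basis_apply, LinearMap.compl₁₂_apply, liftLinear_e, liftLinear_e]
      exact liftLinear_bracket_e h_succ h_comm h_zero i j
    exact LinearMap.congr_fun₂ h x y

variable {X : ℕ → L} (h_succ : ∀ k, ⁅X 0, X (k + 1)⁆ = X (k + 2))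
  (h_comm : ∀ i j, ⁅X (i + 1), X (j + 1)⁆ = 0) (h_zero : X n = 0)

theorem lift_e (k : Fin n) : lift h_succ h_comm h_zero (e n k) = X k :=
  liftLinear_e X k

include h_succ h_comm h_zero in
theorem toSubmodule_lieSpan :
    (LieSubalgebra.lieSpan ℂ L (Set.range fun k : Fin n => X k)).toSubmodule =
      Submodule.span ℂ (Set.range fun k : Fin n => X k) := by
  refine le_antisymm ?_ LieSubalgebra.submodule_span_le_lieSpan
  have h_range : (lift h_succ h_comm h_zero).range.toSubmodule =
      Submodule.span ℂ (Set.range fun k : Fin n => X k) := (basis n).constr_range ℂ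
  rw [← h_range, LieSubalgebra.toSubmodule_le_toSubmodule, LieSubalgebra.lieSpan_le]
  rintro _ ⟨k, rfl⟩
  exact ⟨e n k, lift_e h_succ h_comm h_zero k⟩

theorem range_lift : (lift h_succ h_comm h_zero).range =
    LieSubalgebra.lieSpan ℂ L (Set.range fun k : Fin n => X k) := by
  rw [← LieSubalgebra.toSubmodule_inj, toSubmodule_lieSpan h_succ h_comm h_zero]
  exact (basis n).constr_range ℂ

theorem lift_injective (h_indep : LinearIndependent ℂ fun k : Fin n => X k) :
    Function.Injective (lift h_succ h_comm h_zero) :=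
  (basis n).injective_constr_of_linearIndependent h_indep

/-- The isomorphism of `L_n` with the Lie subalgebra generated by a linearly independent sequence
that satisfies the relations of `L_n`; `X k` stands for `X_{k+1}`. -/
noncomputable def liftEquiv (h_indep : LinearIndependent ℂ fun k : Fin n => X k) :
    ModelFiliform n ≃ₗ⁅ℂ⁆ LieSubalgebra.lieSpan ℂ L (Set.range fun k : Fin n => X k) :=
  (LieEquiv.ofInjective _ (lift_injective h_succ h_comm h_zero h_indep)).trans
    (LieEquiv.ofEq _ _ (congrArg _ (range_lift h_succ h_comm h_zero)))

theorem liftEquiv_e (h_indep : LinearIndependent ℂ fun k : Fin n => X k) (k : Fin n) :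
    (liftEquiv h_succ h_comm h_zero h_indep (e n k) : L) = X k :=
  lift_e h_succ h_comm h_zero k

end Lift

end ModelFiliform

section DimensionThree

variable (α β : ℂ)

/-- The homomorphism from `L_3`, the Heisenberg algebra, to `gl(4,ℂ)` whose range is `𝔥`. -/
noncomputable def hMatrixHom : ModelFiliform 3 →ₗ⁅ℂ⁆ Matrix (Fin 4) (Fin 4) ℂ where
  toFun x := hMatrix α β (x 0) (x 1) (x 2)
  map_add' x y := by
    ext i j
    fin_cases i <;> fin_cases j <;> simp [hMatrix, ModelFiliform.add_apply] <;> ring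
  map_smul' c x := by
    ext i j
    fin_cases i <;> fin_cases j <;> simp [hMatrix, ModelFiliform.smul_apply] <;> ring
  map_lie' {x y} := by
    ext i j
    fin_cases i <;> fin_cases j <;>
      simp [hMatrix, ModelFiliform.bracket_apply, Ring.lie_def] <;> ring

theorem hMatrixHom_injective : Function.Injective (hMatrixHom α β) := by
  intro x y h
  have h_entry (i j : Fin 4) : hMatrixHom α β x i j = hMatrixHom α β y i j := by rw [h]
  funext k
  fin_cases k
  · exact h_entry 0 3
  · exact h_entry 1 3
  · exact h_entry 2 3

theorem mem_range_hMatrixHom {X : Matrix (Fin 4) (Fin 4) ℂ} :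
    X ∈ (hMatrixHom α β).range ↔ ∃ x₁ x₂ x₃ : ℂ, X = hMatrix α β x₁ x₂ x₃ := by
  rw [LieHom.mem_range]
  constructor
  · rintro ⟨x, rfl⟩
    exact ⟨_, _, _, rfl⟩
  · rintro ⟨x₁, x₂, x₃, rfl⟩
    exact ⟨(![x₁, x₂, x₃] : Fin 3 → ℂ), rfl⟩

theorem hMatrix_pow_three : hMatrix α β 1 0 0 ^ 3 =
    !![4, 4, 0, 2; 4, 4, 0, 2; 2 * (α + β), 2 * (α + β), 0, α + β; 0, 0, 0, 0] := by
  rw [pow_three]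
  ext i j
  fin_cases i <;> fin_cases j <;>
    simp [hMatrix, Matrix.mul_apply, Fin.sum_univ_four] <;> ring

theorem hMatrix_pow_four : hMatrix α β 1 0 0 ^ 4 = (2 : ℂ) • hMatrix α β 1 0 0 ^ 3 := by
  rw [pow_succ, hMatrix_pow_three]
  ext i j
  fin_cases i <;> fin_cases j <;> simp [hMatrix, Matrix.mul_apply, Fin.sum_univ_four] <;> ring

theorem isSemisimplePart_hMatrix :
    IsSemisimplePart (hMatrix α β 1 0 0) ((2 ^ 2 : ℂ)⁻¹ • hMatrix α β 1 0 0 ^ 3) :=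
  isSemisimplePart_inv_smul_pow two_ne_zero (hMatrix_pow_four α β)

theorem inv_smul_hMatrix_pow_three_notMem_range :
    (2 ^ 2 : ℂ)⁻¹ • hMatrix α β 1 0 0 ^ 3 ∉ (hMatrixHom α β).range := by
  rw [mem_range_hMatrixHom, hMatrix_pow_three]
  rintro ⟨x₁, x₂, x₃, h⟩
  have h_x₁ : (2 ^ 2)⁻¹ * 2 = x₁ := by simpa [hMatrix] using congrFun₂ h 0 3
  have h_x₂ : (2 ^ 2)⁻¹ * 2 = x₂ := by simpa [hMatrix] using congrFun₂ h 1 3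
  have h_entry : (2 ^ 2)⁻¹ * (2 * (α + β)) = α * x₁ + (β - 1) * x₂ := by
    simpa [hMatrix] using congrFun₂ h 2 0
  rw [← h_x₁, ← h_x₂] at h_entry
  exact one_ne_zero (α := ℂ) (by linear_combination 2 * h_entry)

theorem not_isAlgebraic_range_hMatrixHom : ¬ IsAlgebraic (hMatrixHom α β).range := fun h =>
  inv_smul_hMatrix_pow_three_notMem_range α β <|
    h.semisimplePart_mem ((mem_range_hMatrixHom α β).2 ⟨1, 0, 0, rfl⟩)
      (isSemisimplePart_hMatrix α β)

theorem exists_lieSubalgebra_hMatrix :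
    ∃ L : LieSubalgebra ℂ (Matrix (Fin 4) (Fin 4) ℂ),
      (∀ X, X ∈ L ↔ ∃ x₁ x₂ x₃ : ℂ, X = hMatrix α β x₁ x₂ x₃) ∧
      finrank ℂ L = 3 ∧ LieRing.IsNilpotent L ∧ ¬ IsAlgebraic L :=
  let φ := LieEquiv.ofInjective _ (hMatrixHom_injective α β)
  ⟨(hMatrixHom α β).range, fun _ => mem_range_hMatrixHom α β, ModelFiliform.finrank_of_equiv φ,
    ModelFiliform.isNilpotent_of_equiv φ, not_isAlgebraic_range_hMatrixHom α β⟩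

end DimensionThree

section CoordVec

variable {n : ℕ}

/-- The coordinate vector of `ℂ^(n+1)` with index `p`, replaced by zero for `n ≤ p`: with this
convention `X₁` and `X₂` shift the vectors of index at least `2` without a boundary case. -/
noncomputable def coordVec (n p : ℕ) : Fin (n + 1) → ℂ :=
  fun i => if (i : ℕ) = p ∧ p < n then 1 else 0

/-- The last coordinate vector of `ℂ^(n+1)`. -/
noncomputable def lastVec (n : ℕ) : Fin (n + 1) → ℂ := Pi.single (Fin.last n) 1

theorem coordVec_of_le {p : ℕ} (h : n ≤ p) : coordVec n p = 0 := by
  funext i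
  simp [coordVec, h]

theorem coordVec_castSucc (k : Fin n) : coordVec n k = Pi.single k.castSucc 1 := by
  funext i
  simp [coordVec, Pi.single_apply, Fin.ext_iff]

theorem mulVec_coordVec (M : Matrix (Fin (n + 1)) (Fin (n + 1)) ℂ) {p : ℕ} (hp : p < n) :
    M *ᵥ coordVec n p = fun i => M i ⟨p, by omega⟩ := by
  rw [coordVec_castSucc ⟨p, hp⟩, mulVec_single_one]
  rfl

theorem mulVec_lastVec (M : Matrix (Fin (n + 1)) (Fin (n + 1)) ℂ) :
    M *ᵥ lastVec n = fun i => M i (Fin.last n) :=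
  mulVec_single_one M _

theorem ext_mulVec {M N : Matrix (Fin (n + 1)) (Fin (n + 1)) ℂ}
    (h_zero : M *ᵥ coordVec n 0 = N *ᵥ coordVec n 0)
    (h_one : M *ᵥ coordVec n 1 = N *ᵥ coordVec n 1)
    (h_add_two : ∀ p, M *ᵥ coordVec n (p + 2) = N *ᵥ coordVec n (p + 2))
    (h_last : M *ᵥ lastVec n = N *ᵥ lastVec n) : M = N := by
  ext i j
  induction j using Fin.lastCases with
  | last => simpa only [mulVec_lastVec] using congrFun h_last i
  | cast j =>
    have h_coord : ∀ p, M *ᵥ coordVec n p = N *ᵥ coordVec n p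
      | 0 => h_zero
      | 1 => h_one
      | p + 2 => h_add_two p
    have h_column := h_coord j
    rw [mulVec_coordVec _ j.isLt, mulVec_coordVec _ j.isLt] at h_column
    exact congrFun h_column i

end CoordVec

section Columns

variable (m : ℕ) (a α β : ℂ)

theorem matX₁_mulVec_zero : matX₁ (m + 4) a α β *ᵥ coordVec (m + 4) 0 =
    a • coordVec (m + 4) 0 + a • coordVec (m + 4) 1 + α • coordVec (m + 4) (m + 3) := by
  rw [mulVec_coordVec _ (by omega)]
  funext i
  simp only [Pi.add_apply, Pi.smul_apply, smul_eq_mul, coordVec, matX₁, of_apply]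
  grind

theorem matX₁_mulVec_one : matX₁ (m + 4) a α β *ᵥ coordVec (m + 4) 1 =
    a • coordVec (m + 4) 0 + a • coordVec (m + 4) 1 + β • coordVec (m + 4) (m + 3) := by
  rw [mulVec_coordVec _ (by omega)]
  funext i
  simp only [Pi.add_apply, Pi.smul_apply, smul_eq_mul, coordVec, matX₁, of_apply]
  grind

theorem matX₁_mulVec_add_two (n p : ℕ) : matX₁ n a α β *ᵥ coordVec n (p + 2) =
    ((p + 1) / (p + 2) : ℂ) • coordVec n (p + 3) := by
  rcases lt_or_ge (p + 2) n with hp | hp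
  · rw [mulVec_coordVec _ hp]
    funext i
    simp only [Pi.smul_apply, smul_eq_mul, coordVec, matX₁, of_apply]
    grind
  · rw [coordVec_of_le hp, coordVec_of_le (by omega), mulVec_zero, smul_zero]

theorem matX₁_mulVec_lastVec :
    matX₁ (m + 4) a α β *ᵥ lastVec (m + 4) = coordVec (m + 4) 0 := by
  rw [mulVec_lastVec]
  funext i
  simp only [coordVec, matX₁, of_apply, Fin.val_last]
  grind

theorem matX₂_mulVec_zero : matX₂ (m + 4) a α β *ᵥ coordVec (m + 4) 0 =
    a • coordVec (m + 4) 0 + a • coordVec (m + 4) 1 - coordVec (m + 4) 2 +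
      β • coordVec (m + 4) (m + 3) := by
  rw [mulVec_coordVec _ (by omega)]
  funext i
  simp only [Pi.add_apply, Pi.sub_apply, Pi.smul_apply, smul_eq_mul, coordVec, matX₂, of_apply]
  grind

theorem matX₂_mulVec_one : matX₂ (m + 4) a α β *ᵥ coordVec (m + 4) 1 =
    a • coordVec (m + 4) 0 + a • coordVec (m + 4) 1 + coordVec (m + 4) 2 +
      α • coordVec (m + 4) (m + 3) := by
  rw [mulVec_coordVec _ (by omega)]
  funext i
  simp only [Pi.add_apply, Pi.smul_apply, smul_eq_mul, coordVec, matX₂, of_apply]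
  grind

theorem matX₂_mulVec_add_two (n p : ℕ) : matX₂ n a α β *ᵥ coordVec n (p + 2) =
    (1 / (p + 2) : ℂ) • coordVec n (p + 3) := by
  rcases lt_or_ge (p + 2) n with hp | hp
  · rw [mulVec_coordVec _ hp]
    funext i
    simp only [Pi.smul_apply, smul_eq_mul, coordVec, matX₂, of_apply]
    grind
  · rw [coordVec_of_le hp, coordVec_of_le (by omega), mulVec_zero, smul_zero]

theorem matX₂_mulVec_lastVec :
    matX₂ (m + 4) a α β *ᵥ lastVec (m + 4) = coordVec (m + 4) 1 := by
  rw [mulVec_lastVec]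
  funext i
  simp only [coordVec, matX₂, of_apply, Fin.val_last]
  grind

end Columns

section PowMul

variable {R : Type*} [Ring R]

theorem lie_mul_eq_add (x y z : R) : ⁅x, y * z⁆ = ⁅x, y⁆ * z + y * ⁅x, z⁆ := by
  simp only [Ring.lie_def]
  noncomm_ring

theorem lie_pow_mul {x y z : R} (h_lie_left : ⁅x, y⁆ = z) (h_comm : Commute y z)
    (h_lie_right : ⁅x, z⁆ = 2 • (y * z)) (h_sq : z * z = y * y * z) (k : ℕ) :
    ⁅x, y ^ k * z⁆ = (k + 2) • (y ^ (k + 1) * z) := by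
  induction k with
  | zero => rw [pow_zero, one_mul, h_lie_right, zero_add, zero_add, pow_one]
  | succ k ih =>
    have h_swap : z * (y ^ k * z) = y ^ (k + 2) * z := by
      rw [← mul_assoc, ← (h_comm.pow_left k).eq, mul_assoc, h_sq, ← mul_assoc, ← sq, ← pow_add]
    rw [pow_succ', mul_assoc, lie_mul_eq_add, h_lie_left, h_swap, ih, mul_smul_comm, ← mul_assoc,
      ← pow_succ']
    exact (succ_nsmul' _ _).symm

end PowMul

section Relations

variable (m : ℕ) (a α β : ℂ)

theorem genX_two_mulVec {n : ℕ} (v : Fin (n + 1) → ℂ) : genX n a α β 2 *ᵥ v =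
    matX₁ n a α β *ᵥ matX₂ n a α β *ᵥ v - matX₂ n a α β *ᵥ matX₁ n a α β *ᵥ v := by
  rw [genX, genX, Ring.lie_def, sub_mulVec, mulVec_mulVec, mulVec_mulVec]

theorem genX_two_mulVec_zero : genX (m + 4) a α β 2 *ᵥ coordVec (m + 4) 0 =
    (-1 / 2 : ℂ) • coordVec (m + 4) 3 := by
  simp only [genX_two_mulVec, mulVec_add, mulVec_sub, mulVec_smul, matX₁_mulVec_zero,
    matX₁_mulVec_one, matX₂_mulVec_zero, matX₂_mulVec_one, matX₁_mulVec_add_two,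
    matX₂_mulVec_add_two, zero_add, coordVec_of_le le_rfl]
  module

theorem genX_two_mulVec_one : genX (m + 4) a α β 2 *ᵥ coordVec (m + 4) 1 =
    (1 / 2 : ℂ) • coordVec (m + 4) 3 := by
  simp only [genX_two_mulVec, mulVec_add, mulVec_smul, matX₁_mulVec_zero,
    matX₁_mulVec_one, matX₂_mulVec_zero, matX₂_mulVec_one, matX₁_mulVec_add_two,
    matX₂_mulVec_add_two, zero_add, coordVec_of_le le_rfl]
  module

theorem genX_two_mulVec_add_two (n p : ℕ) : genX n a α β 2 *ᵥ coordVec n (p + 2) =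
    (1 / ((p + 2) * (p + 3)) : ℂ) • coordVec n (p + 4) := by
  simp only [genX_two_mulVec, mulVec_smul, matX₁_mulVec_add_two, matX₂_mulVec_add_two]
  match_scalars
  field_simp
  ring

theorem genX_two_mulVec_lastVec :
    genX (m + 4) a α β 2 *ᵥ lastVec (m + 4) = coordVec (m + 4) 2 := by
  rw [genX_two_mulVec, matX₁_mulVec_lastVec, matX₂_mulVec_lastVec, matX₁_mulVec_one,
    matX₂_mulVec_zero]
  module

theorem commute_matX₂_genX_two :
    Commute (matX₂ (m + 4) a α β) (genX (m + 4) a α β 2) := by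
  apply ext_mulVec <;> intros <;>
    simp only [← mulVec_mulVec, mulVec_add, mulVec_sub, mulVec_smul, matX₂_mulVec_zero,
      matX₂_mulVec_one, matX₂_mulVec_add_two, matX₂_mulVec_lastVec, genX_two_mulVec_zero,
      genX_two_mulVec_one, genX_two_mulVec_add_two, genX_two_mulVec_lastVec]
  · rw [coordVec_of_le (p := m + 5) (by omega)]; module
  · rw [coordVec_of_le (p := m + 5) (by omega)]; module
  · match_scalars
    simp only [add_assoc]
    norm_num1
    field_simp
  · module

theorem lie_matX₁_genX_two : ⁅matX₁ (m + 4) a α β, genX (m + 4) a α β 2⁆ =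
    2 • (matX₂ (m + 4) a α β * genX (m + 4) a α β 2) := by
  apply ext_mulVec <;> intros <;>
    simp only [Ring.lie_def, sub_mulVec, smul_mulVec, ← mulVec_mulVec, mulVec_add, mulVec_smul,
      matX₁_mulVec_zero, matX₁_mulVec_one, matX₁_mulVec_add_two, matX₁_mulVec_lastVec,
      matX₂_mulVec_add_two, genX_two_mulVec_zero, genX_two_mulVec_one,
      genX_two_mulVec_add_two, genX_two_mulVec_lastVec]
  · rw [coordVec_of_le (p := m + 5) (by omega)]; module
  · rw [coordVec_of_le (p := m + 5) (by omega)]; module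
  · match_scalars
    simp only [add_assoc]
    norm_num1
    field_simp
    ring
  · module

theorem genX_two_mul_self : genX (m + 4) a α β 2 * genX (m + 4) a α β 2 =
    matX₂ (m + 4) a α β * matX₂ (m + 4) a α β * genX (m + 4) a α β 2 := by
  apply ext_mulVec <;> intros <;>
    simp only [← mulVec_mulVec, mulVec_smul, matX₂_mulVec_add_two, genX_two_mulVec_zero,
      genX_two_mulVec_one, genX_two_mulVec_add_two, genX_two_mulVec_lastVec]
  · module
  · module
  · match_scalars; field_simp; ring
  · module

end Relations

section FiliformRelations

open scoped Nat

variable (m : ℕ) (a α β : ℂ)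

theorem genX_add_two (k : ℕ) : genX (m + 4) a α β (k + 2) =
    (k + 1)! • (matX₂ (m + 4) a α β ^ k * genX (m + 4) a α β 2) := by
  induction k with
  | zero => simp
  | succ k ih =>
    have h_lie := lie_pow_mul (y := matX₂ (m + 4) a α β) (z := genX (m + 4) a α β 2) rfl
      (commute_matX₂_genX_two m a α β) (lie_matX₁_genX_two m a α β) (genX_two_mul_self m a α β) k
    rw [genX, ih, lie_nsmul, h_lie, smul_smul, Nat.factorial_succ (k + 1), mul_comm]

theorem commute_genX_succ_of_commute {Y : Matrix (Fin (m + 4 + 1)) (Fin (m + 4 + 1)) ℂ}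
    (h₂ : Commute Y (matX₂ (m + 4) a α β)) (h₃ : Commute Y (genX (m + 4) a α β 2)) :
    ∀ k, Commute Y (genX (m + 4) a α β (k + 1))
  | 0 => h₂
  | k + 1 => by
    rw [genX_add_two]
    exact ((h₂.pow_right k).mul_right h₃).smul_right _

theorem commute_genX_succ (i j : ℕ) :
    Commute (genX (m + 4) a α β (i + 1)) (genX (m + 4) a α β (j + 1)) := by
  have h_comm := commute_matX₂_genX_two m a α β
  exact commute_genX_succ_of_commute m a α β
    (commute_genX_succ_of_commute m a α β (Commute.refl _) h_comm i).symm
    (commute_genX_succ_of_commute m a α β h_comm.symm (Commute.refl _) i).symm j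

theorem matX₂_pow_mulVec_add_two (n k p : ℕ) : (matX₂ n a α β ^ k) *ᵥ coordVec n (p + 2) =
    ((p + 1)! / (p + k + 1)! : ℂ) • coordVec n (p + k + 2) := by
  induction k with
  | zero => simp [Nat.factorial_ne_zero]
  | succ k ih =>
    rw [pow_succ', ← mulVec_mulVec, ih, mulVec_smul, matX₂_mulVec_add_two, smul_smul,
      ← add_assoc, Nat.factorial_succ (p + k + 1)]
    congr 1
    push_cast
    field_simp
    ring

theorem genX_mulVec_lastVec : ∀ k, genX (m + 4) a α β k *ᵥ lastVec (m + 4) = coordVec (m + 4) k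
  | 0 => matX₁_mulVec_lastVec m a α β
  | 1 => matX₂_mulVec_lastVec m a α β
  | k + 2 => by
    rw [genX_add_two, smul_mulVec, ← mulVec_mulVec, genX_two_mulVec_lastVec, ← zero_add 2,
      matX₂_pow_mulVec_add_two, zero_add, ← Nat.cast_smul_eq_nsmul ℂ, smul_smul]
    simp [Nat.factorial_ne_zero]

theorem genX_add_four_eq_zero : genX (m + 4) a α β (m + 4) = 0 := by
  have h_pow {p : ℕ} (hp : 2 ≤ p) :
      (matX₂ (m + 4) a α β ^ (m + 2)) *ᵥ coordVec (m + 4) p = 0 := by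
    obtain ⟨p, rfl⟩ := Nat.exists_eq_add_of_le' hp
    rw [matX₂_pow_mulVec_add_two, coordVec_of_le (by omega), smul_zero]
  rw [genX_add_two]
  apply ext_mulVec <;> intros <;>
    simp only [smul_mulVec, ← mulVec_mulVec, mulVec_smul, genX_two_mulVec_zero,
      genX_two_mulVec_one, genX_two_mulVec_add_two, genX_two_mulVec_lastVec, zero_mulVec]
  all_goals rw [h_pow (by omega)]; simp only [smul_zero]

theorem linearIndependent_genX :
    LinearIndependent ℂ fun k : Fin (m + 4) => genX (m + 4) a α β k := by
  refine .of_comp (mulVecBilin ℂ ℂ |>.flip (lastVec (m + 4))) ?_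
  have h_single := (Pi.linearIndependent_single_one (Fin (m + 4 + 1)) ℂ).comp _
    (Fin.castSucc_injective (m + 4))
  convert h_single using 1
  funext k
  exact (genX_mulVec_lastVec m a α β k).trans (coordVec_castSucc k)

/-- The isomorphism `L_n → 𝔥_n` with `e_i ↦ X_i`, for `n = m + 4`. -/
noncomputable def hAlgEquiv : ModelFiliform (m + 4) ≃ₗ⁅ℂ⁆ hAlg (m + 4) a α β :=
  ModelFiliform.liftEquiv (fun _ => rfl) (fun i j => (commute_genX_succ m a α β i j).lie_eq)
    (genX_add_four_eq_zero m a α β) (linearIndependent_genX m a α β)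

theorem hAlgEquiv_e (k : Fin (m + 4)) :
    (hAlgEquiv m a α β (ModelFiliform.e (m + 4) k) : Matrix _ _ ℂ) = genX (m + 4) a α β k :=
  ModelFiliform.liftEquiv_e _ _ _ _ k

theorem toSubmodule_hAlg : (hAlg (m + 4) a α β).toSubmodule =
    Submodule.span ℂ (Set.range fun k : Fin (m + 4) => genX (m + 4) a α β k) :=
  ModelFiliform.toSubmodule_lieSpan (fun _ => rfl)
    (fun i j => (commute_genX_succ m a α β i j).lie_eq) (genX_add_four_eq_zero m a α β)

end FiliformRelations

section NotAlgebraic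

variable (m : ℕ) (a α β : ℂ)

theorem mulVec_apply_two_add_mulVec_apply_one_eq_zero
    {M : Matrix (Fin (m + 4 + 1)) (Fin (m + 4 + 1)) ℂ}
    (hM : M ∈ hAlg (m + 4) a α β) :
    (M *ᵥ coordVec (m + 4) 0) ⟨2, by omega⟩ + (M *ᵥ lastVec (m + 4)) ⟨1, by omega⟩ = 0 := by
  rw [← LieSubalgebra.mem_toSubmodule, toSubmodule_hAlg] at hM
  induction hM using Submodule.span_induction with
  | zero => simp
  | add M N _ _ hM hN =>
    simp only [add_mulVec, Pi.add_apply]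
    linear_combination hM + hN
  | smul c M _ hM =>
    simp only [smul_mulVec, Pi.smul_apply, smul_eq_mul]
    linear_combination c * hM
  | mem M hM =>
    obtain ⟨⟨k, _⟩, rfl⟩ := hM
    match k with
    | 0 => simp [genX, matX₁_mulVec_zero, matX₁_mulVec_lastVec, coordVec]
    | 1 => simp [genX, matX₂_mulVec_zero, matX₂_mulVec_lastVec, coordVec]
    | k + 2 =>
      dsimp only
      rw [genX_mulVec_lastVec, genX_add_two, smul_mulVec, ← mulVec_mulVec, genX_two_mulVec_zero,
        mulVec_smul, matX₂_pow_mulVec_add_two _ _ _ _ _ 1]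
      simp [coordVec]

theorem matX₁_pow_mulVec_eq_zero {n p j : ℕ} (h : n ≤ p + 2 + j) :
    (matX₁ n a α β ^ j) *ᵥ coordVec n (p + 2) = 0 := by
  induction j generalizing p with
  | zero => rw [coordVec_of_le (by omega), mulVec_zero]
  | succ j ih =>
    rw [pow_succ, ← mulVec_mulVec, matX₁_mulVec_add_two, mulVec_smul, ih (by omega), smul_zero]

theorem matX₁_mul_self_mulVec_zero :
    matX₁ (m + 4) a α β *ᵥ matX₁ (m + 4) a α β *ᵥ coordVec (m + 4) 0 =
      (2 * a) • matX₁ (m + 4) a α β *ᵥ coordVec (m + 4) 0 +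
        (a * (β - α)) • coordVec (m + 4) (m + 3) := by
  simp only [mulVec_add, mulVec_smul, matX₁_mulVec_zero, matX₁_mulVec_one, matX₁_mulVec_add_two,
    coordVec_of_le le_rfl]
  module

theorem matX₁_mul_self_mulVec_one :
    matX₁ (m + 4) a α β *ᵥ matX₁ (m + 4) a α β *ᵥ coordVec (m + 4) 1 =
      (2 * a) • matX₁ (m + 4) a α β *ᵥ coordVec (m + 4) 1 +
        (a * (α - β)) • coordVec (m + 4) (m + 3) := by
  simp only [mulVec_add, mulVec_smul, matX₁_mulVec_zero, matX₁_mulVec_one, matX₁_mulVec_add_two,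
    coordVec_of_le le_rfl]
  module

theorem matX₁_pow_add_two_mulVec_of_eq {v : Fin (m + 4 + 1) → ℂ} {c : ℂ} {j : ℕ}
    (hv : matX₁ (m + 4) a α β *ᵥ matX₁ (m + 4) a α β *ᵥ v =
      (2 * a) • matX₁ (m + 4) a α β *ᵥ v + c • coordVec (m + 4) (m + 3)) (hj : 1 ≤ j ∨ c = 0) :
    (matX₁ (m + 4) a α β ^ (j + 2)) *ᵥ v = (2 * a) • (matX₁ (m + 4) a α β ^ (j + 1)) *ᵥ v := by
  have h_kernel : c • (matX₁ (m + 4) a α β ^ j) *ᵥ coordVec (m + 4) (m + 3) = 0 := by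
    rcases hj with hj | rfl
    · rw [matX₁_pow_mulVec_eq_zero (p := m + 1) _ _ _ (by omega), smul_zero]
    · exact zero_smul _ _
  rw [pow_add, pow_two, ← mulVec_mulVec, ← mulVec_mulVec, hv, mulVec_add, mulVec_smul, mulVec_smul,
    h_kernel, add_zero, mulVec_mulVec, ← pow_succ]

theorem matX₁_pow_succ_mulVec_lastVec (k : ℕ) :
    (matX₁ (m + 4) a α β ^ (k + 1)) *ᵥ lastVec (m + 4) =
      (matX₁ (m + 4) a α β ^ k) *ᵥ coordVec (m + 4) 0 := by
  rw [pow_succ, ← mulVec_mulVec, matX₁_mulVec_lastVec]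

theorem matX₁_pow_add_three {j : ℕ} (hm : m ≤ j) (hj : 1 ≤ j ∨ α = β) :
    matX₁ (m + 4) a α β ^ (j + 3) = (2 * a) • matX₁ (m + 4) a α β ^ (j + 2) := by
  have h_zero (i : ℕ) (hi : 1 ≤ i ∨ α = β) := matX₁_pow_add_two_mulVec_of_eq (j := i) m a α β
    (matX₁_mul_self_mulVec_zero m a α β) (hi.imp_right fun h => by rw [h, sub_self, mul_zero])
  have h_one := matX₁_pow_add_two_mulVec_of_eq (j := j + 1) m a α β
    (matX₁_mul_self_mulVec_one m a α β) (.inl (by omega))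
  apply ext_mulVec
  · rw [smul_mulVec]
    exact h_zero (j + 1) (.inl (by omega))
  · rw [smul_mulVec]
    exact h_one
  · intro p
    rw [smul_mulVec, matX₁_pow_mulVec_eq_zero _ _ _ (by omega),
      matX₁_pow_mulVec_eq_zero _ _ _ (by omega), smul_zero]
  · rw [smul_mulVec, matX₁_pow_succ_mulVec_lastVec, matX₁_pow_succ_mulVec_lastVec]
    exact h_zero j hj

theorem matX₁_pow_add_two_mulVec_zero (j : ℕ) :
    (matX₁ (m + 4) a α β ^ (j + 2)) *ᵥ coordVec (m + 4) 0 =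
      (2 * a) ^ j • (matX₁ (m + 4) a α β ^ 2) *ᵥ coordVec (m + 4) 0 := by
  induction j with
  | zero => rw [zero_add, pow_zero, one_smul]
  | succ j ih =>
    rw [matX₁_pow_add_two_mulVec_of_eq m a α β (matX₁_mul_self_mulVec_zero m a α β)
      (.inl (by omega)), ih, smul_smul, pow_succ' (2 * a)]

theorem matX₁_sq_mulVec_zero : (matX₁ (m + 4) a α β ^ 2) *ᵥ coordVec (m + 4) 0 =
    (2 * a ^ 2) • coordVec (m + 4) 0 + (2 * a ^ 2) • coordVec (m + 4) 1 +
      (a * (α + β)) • coordVec (m + 4) (m + 3) := by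
  rw [sq, ← mulVec_mulVec, matX₁_mul_self_mulVec_zero, matX₁_mulVec_zero]
  module

theorem isSemisimplePart_matX₁ {a : ℂ} (ha : a ≠ 0) : IsSemisimplePart (matX₁ (m + 4) a α β)
    (((2 * a) ^ (m + 2))⁻¹ • matX₁ (m + 4) a α β ^ (m + 3)) :=
  isSemisimplePart_inv_smul_pow (mul_ne_zero two_ne_zero ha)
    (matX₁_pow_add_three m a α β (Nat.le_succ m) (.inl (by omega)))

theorem inv_smul_matX₁_pow_eq {a : ℂ} (ha : a ≠ 0) (h : 1 ≤ m ∨ α = β) :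
    ((2 * a) ^ (m + 2))⁻¹ • matX₁ (m + 4) a α β ^ (m + 3) =
      ((2 * a) ^ (m + 1))⁻¹ • matX₁ (m + 4) a α β ^ (m + 2) := by
  rw [matX₁_pow_add_three m a α β le_rfl h, smul_smul]
  congr 1
  field_simp
  ring

theorem inv_smul_matX₁_pow_notMem_hAlg {a : ℂ} (ha : a ≠ 0) :
    ((2 * a) ^ (m + 2))⁻¹ • matX₁ (m + 4) a α β ^ (m + 3) ∉ hAlg (m + 4) a α β := by
  rw [← LieSubalgebra.mem_toSubmodule,
    Submodule.smul_mem_iff _ (inv_ne_zero (pow_ne_zero _ (mul_ne_zero two_ne_zero ha)))]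
  intro h
  have h_entries := mulVec_apply_two_add_mulVec_apply_one_eq_zero m a α β h
  rw [matX₁_pow_succ_mulVec_lastVec, matX₁_pow_add_two_mulVec_zero m _ _ _ (m + 1),
    matX₁_pow_add_two_mulVec_zero m _ _ _ m, matX₁_sq_mulVec_zero] at h_entries
  simp [coordVec, ha] at h_entries

theorem matX₁_mem_hAlg : matX₁ (m + 4) a α β ∈ hAlg (m + 4) a α β :=
  LieSubalgebra.subset_lieSpan ⟨0, rfl⟩

theorem not_isAlgebraic_hAlg {a : ℂ} (ha : a ≠ 0) : ¬ IsAlgebraic (hAlg (m + 4) a α β) := fun h =>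
  inv_smul_matX₁_pow_notMem_hAlg m α β ha <|
    h.semisimplePart_mem (matX₁_mem_hAlg m a α β) (isSemisimplePart_matX₁ m α β ha)

end NotAlgebraic

end NonAlgebraicNilpotent

theorem mainTheorem2_general :
    (∀ n : ℕ, 3 ≤ n →
      ∃ (m : ℕ) (L : LieSubalgebra ℂ (Matrix (Fin m) (Fin m) ℂ)),
        Module.finrank ℂ L = n ∧ LieRing.IsNilpotent L ∧
          ¬ NonAlgebraicNilpotent.IsAlgebraic L) ∧
    (∀ α β : ℂ,
      ∃ L : LieSubalgebra ℂ (Matrix (Fin 4) (Fin 4) ℂ),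
        (∀ X : Matrix (Fin 4) (Fin 4) ℂ,
          X ∈ L ↔ ∃ x₁ x₂ x₃ : ℂ, X = NonAlgebraicNilpotent.hMatrix α β x₁ x₂ x₃) ∧
        Module.finrank ℂ L = 3 ∧ LieRing.IsNilpotent L ∧
        ¬ NonAlgebraicNilpotent.IsAlgebraic L) ∧
    (∀ (n : ℕ), 4 ≤ n → ∀ a α β : ℂ,
      Module.finrank ℂ (NonAlgebraicNilpotent.hAlg n a α β) = n ∧
      LieRing.IsNilpotent (NonAlgebraicNilpotent.hAlg n a α β) ∧
      (∃ φ : NonAlgebraicNilpotent.ModelFiliform n ≃ₗ⁅ℂ⁆ NonAlgebraicNilpotent.hAlg n a α β,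
        ∀ k : Fin n,
          (φ (NonAlgebraicNilpotent.ModelFiliform.e n k) :
            Matrix (Fin (n + 1)) (Fin (n + 1)) ℂ) = NonAlgebraicNilpotent.genX n a α β k) ∧
      (a ≠ 0 →
        (∃ S : Matrix (Fin (n + 1)) (Fin (n + 1)) ℂ,
          NonAlgebraicNilpotent.IsSemisimplePart (NonAlgebraicNilpotent.matX₁ n a α β) S ∧
          S ∉ NonAlgebraicNilpotent.hAlg n a α β ∧
          S = ((2 * a) ^ (n - 2))⁻¹ • NonAlgebraicNilpotent.matX₁ n a α β ^ (n - 1) ∧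
          (5 ≤ n ∨ α = β →
            S = ((2 * a) ^ (n - 3))⁻¹ • NonAlgebraicNilpotent.matX₁ n a α β ^ (n - 2))) ∧
        ¬ NonAlgebraicNilpotent.IsAlgebraic (NonAlgebraicNilpotent.hAlg n a α β))) := by
  open NonAlgebraicNilpotent in
  refine ⟨fun n hn => ?_, exists_lieSubalgebra_hMatrix, fun n hn a α β => ?_⟩
  · rcases hn.eq_or_lt with rfl | hn
    · obtain ⟨L, -, hL⟩ := exists_lieSubalgebra_hMatrix 0 0
      exact ⟨4, L, hL⟩
    · obtain ⟨m, rfl⟩ := Nat.exists_eq_add_of_le' hn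
      let φ := hAlgEquiv m 1 0 0
      exact ⟨m + 4 + 1, hAlg (m + 4) 1 0 0, ModelFiliform.finrank_of_equiv φ,
        ModelFiliform.isNilpotent_of_equiv φ, not_isAlgebraic_hAlg m 0 0 one_ne_zero⟩
  · obtain ⟨m, rfl⟩ := Nat.exists_eq_add_of_le' hn
    let φ := hAlgEquiv m a α β
    refine ⟨ModelFiliform.finrank_of_equiv φ, ModelFiliform.isNilpotent_of_equiv φ,
      ⟨φ, hAlgEquiv_e m a α β⟩, fun ha => ⟨?_, not_isAlgebraic_hAlg m α β ha⟩⟩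
    exact ⟨_, isSemisimplePart_matX₁ m α β ha, inv_smul_matX₁_pow_notMem_hAlg m α β ha, rfl,
      fun h => inv_smul_matX₁_pow_eq m α β ha (h.imp_left fun h => by omega)⟩

theorem mainTheorem2 :
    (∀ n : ℕ, 3 ≤ n →
      ∃ (m : ℕ) (L : LieSubalgebra ℂ (Matrix (Fin m) (Fin m) ℂ)),
        Module.finrank ℂ L = n ∧ LieRing.IsNilpotent L ∧
          ¬ NonAlgebraicNilpotent.IsAlgebraic L) ∧
    (∀ α β : ℂ, α + β ≠ 0 →
      ∃ L : LieSubalgebra ℂ (Matrix (Fin 4) (Fin 4) ℂ),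
        (∀ X : Matrix (Fin 4) (Fin 4) ℂ,
          X ∈ L ↔ ∃ x₁ x₂ x₃ : ℂ, X = NonAlgebraicNilpotent.hMatrix α β x₁ x₂ x₃) ∧
        Module.finrank ℂ L = 3 ∧ LieRing.IsNilpotent L ∧
        ¬ NonAlgebraicNilpotent.IsAlgebraic L) ∧
    (∀ (n : ℕ), 4 ≤ n → ∀ a α β : ℂ, a ≠ 0 →
      Module.finrank ℂ (NonAlgebraicNilpotent.hAlg n a α β) = n ∧
      LieRing.IsNilpotent (NonAlgebraicNilpotent.hAlg n a α β) ∧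
      (∃ φ : NonAlgebraicNilpotent.ModelFiliform n ≃ₗ⁅ℂ⁆ NonAlgebraicNilpotent.hAlg n a α β,
        ∀ k : Fin n,
          (φ (NonAlgebraicNilpotent.ModelFiliform.e n k) :
            Matrix (Fin (n + 1)) (Fin (n + 1)) ℂ) = NonAlgebraicNilpotent.genX n a α β k) ∧
      (∃ S : Matrix (Fin (n + 1)) (Fin (n + 1)) ℂ,
        NonAlgebraicNilpotent.IsSemisimplePart (NonAlgebraicNilpotent.matX₁ n a α β) S ∧
        S ∉ NonAlgebraicNilpotent.hAlg n a α β ∧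
        S = ((2 * a) ^ (n - 2))⁻¹ • NonAlgebraicNilpotent.matX₁ n a α β ^ (n - 1) ∧
        (5 ≤ n ∨ α = β →
          S = ((2 * a) ^ (n - 3))⁻¹ • NonAlgebraicNilpotent.matX₁ n a α β ^ (n - 2))) ∧
      ¬ NonAlgebraicNilpotent.IsAlgebraic (NonAlgebraicNilpotent.hAlg n a α β)) := by
  obtain ⟨h₁, h₂, h₃⟩ := mainTheorem2_general
  refine ⟨h₁, fun α β _ => h₂ α β, fun n hn a α β ha => ?_⟩
  obtain ⟨h_finrank, h_nilpotent, h_equiv, h⟩ := h₃ n hn a α β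
  exact ⟨h_finrank, h_nilpotent, h_equiv, h ha⟩
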